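/- **Proposition (Every $\mathrm{CAT}(\kappa)$ space satisfies the $\mathrm{PT}_\kappa$ inequality).** Let $\kappa\in\mathbb R$ and let $(X,d)$ be a $\mathrm{CAT}(\kappa)$ space; if $\kappa>0$, assume in addition that $d(x,y)\le \pi/\sqrt\kappa$ for all $x,y\in X$. Then for all $x_1,x_2,x_3,x_4\in X$, with $\rho_{ij}=d(x_i,x_j)$, $$\operatorname{sn}_\kappa\!\left(\tfrac{\rho_{13}}2\right)\operatorname{sn}_\kappa\!\left(\tfrac{\rho_{24}}2\right)\le \operatorname{sn}_\kappa\!\left(\tfrac{\rho_{12}}2\right)\operatorname{sn}_\kappa\!\left(\tfrac{\rho_{34}}2\right)+\operatorname{sn}_\kappa\!\left(\tfrac{\rho_{14}}2\right)\operatorname{sn}_\kappa\!\left(\tfrac{\rho_{23}}2\right),$$ where $\operatorname{sn}_\kappa(t)=\frac1{\sqrt\kappa}\sin(\sqrt\kappa\,t)$ if $\kappa>0$, $\operatorname{sn}_0(t)=t$, and $\operatorname{sn}_\kappa(t)=\frac1{\sqrt{-\kappa}}\sinh(\sqrt{-\kappa}\,t)$ if $\kappa<0$. Here a metric space $X$ is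 a $\mathrm{CAT}(\kappa)$ space if, with $D_\kappa=\pi/\sqrt\kappa$ for $\kappa>0$ and $D_\kappa=\infty$ for $\kappa\le0$, any two points of $X$ at distance less than $D_\kappa$ are joined by a geodesic segment, and for every geodesic triangle $\Delta$ in $X$ of perimeter less than $2D_\kappa$, every comparison triangle $\bar\Delta$ (a triangle with the same side lengths) in the model plane $M_\kappa^2$ of constant curvature $\kappa$, and all $x,y\in\Delta$ with comparison points $\bar x,\bar y\in\bar\Delta$, one has $d(x,y)\le d(\bar x,\bar y)$. -/

import Mathlib

namespace CATPT

/-- The generalized sine function `sn_κ`. -/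
noncomputable def sn (κ x : ℝ) : ℝ :=
  if 0 < κ then (1 / √κ) * Real.sin (√κ * x)
  else if κ = 0 then x
  else (1 / √(-κ)) * Real.sinh (√(-κ) * x)

/-- The four-point `PT_κ` inequality for all quadruples of points of `X`. -/
def SatisfiesPT (κ : ℝ) (X : Type*) [MetricSpace X] : Prop :=
  ∀ x₁ x₂ x₃ x₄ : X,
    sn κ (dist x₁ x₃ / 2) * sn κ (dist x₂ x₄ / 2) ≤
      sn κ (dist x₁ x₂ / 2) * sn κ (dist x₃ x₄ / 2) +
        sn κ (dist x₁ x₄ / 2) * sn κ (dist x₂ x₃ / 2)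

/-- `S` is a geodesic segment from `p` to `q`: the image of an isometric embedding
of the interval `[0, d(p,q)]` starting at `p` and ending at `q`. -/
def IsGeodesicSegment {X : Type*} [MetricSpace X] (S : Set X) (p q : X) : Prop :=
  ∃ c : ℝ → X, c 0 = p ∧ c (dist p q) = q ∧
    (∀ s ∈ Set.Icc 0 (dist p q), ∀ t ∈ Set.Icc 0 (dist p q), dist (c s) (c t) = |s - t|) ∧
    S = c '' Set.Icc 0 (dist p q)

/-- A geodesic triangle: three vertices and a choice of three geodesic segments joining them.
The side with index `i` joins the vertices `i` and `i + 1` (indices modulo `3`). -/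
structure GeodesicTriangle (X : Type*) [MetricSpace X] where
  vertex : Fin 3 → X
  side : Fin 3 → Set X
  isGeodesicSegment_side : ∀ i, IsGeodesicSegment (side i) (vertex i) (vertex (i + 1))

/-- The sum of the side lengths. -/
noncomputable def GeodesicTriangle.perimeter {X : Type*} [MetricSpace X]
    (T : GeodesicTriangle X) : ℝ :=
  ∑ i : Fin 3, dist (T.vertex i) (T.vertex (i + 1))

/-- `v` is (the triple of vertices of) a comparison triangle for `T`, in a space `M`
with distance function `δ`. -/
def IsComparisonTriangle {X : Type*} [MetricSpace X] {M : Type*} (δ : M → M → ℝ)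
    (T : GeodesicTriangle X) (v : Fin 3 → M) : Prop :=
  ∀ i, δ (v i) (v (i + 1)) = dist (T.vertex i) (T.vertex (i + 1))

/-- `x'` is the comparison point, on the side with index `i` of the comparison triangle `v`,
of the point `x` of the side with index `i` of `T`. As `x` lies on a geodesic, the two equations
say that `x'` lies on a geodesic from `v i` to `v (i + 1)`, at distance `d(T.vertex i, x)`
from `v i`. -/
def IsComparisonPoint {X : Type*} [MetricSpace X] {M : Type*} (δ : M → M → ℝ)
    (T : GeodesicTriangle X) (v : Fin 3 → M) (i : Fin 3) (x : X) (x' : M) : Prop :=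
  δ (v i) x' = dist (T.vertex i) x ∧ δ x' (v (i + 1)) = dist x (T.vertex (i + 1))

/-- The triangle `T` is not thicker than its comparison triangles in `M`. -/
def SatisfiesComparison {X : Type*} [MetricSpace X] {M : Type*} (δ : M → M → ℝ)
    (T : GeodesicTriangle X) : Prop :=
  ∀ v : Fin 3 → M, IsComparisonTriangle δ T v →
    ∀ i j : Fin 3, ∀ x ∈ T.side i, ∀ y ∈ T.side j, ∀ x' y' : M,
      IsComparisonPoint δ T v i x x' → IsComparisonPoint δ T v j y y' →
        dist x y ≤ δ x' y'

/-- The distance of the model plane of curvature `κ > 0`: the angular distance on the unit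
sphere in `ℝ³`, divided by `√κ`. -/
noncomputable def sphereDist (κ : ℝ)
    (x y : Metric.sphere (0 : EuclideanSpace ℝ (Fin 3)) 1) : ℝ :=
  InnerProductGeometry.angle (x : EuclideanSpace ℝ (Fin 3)) (y : EuclideanSpace ℝ (Fin 3)) / √κ

/-- The distance of the model plane of curvature `κ < 0`: the hyperbolic distance (of
curvature `-1`) on the upper half plane, divided by `√(-κ)`. -/
noncomputable def hyperbolicDist (κ : ℝ) (x y : UpperHalfPlane) : ℝ :=
  dist x y / √(-κ)

/-- The `CAT(κ)` inequality for a geodesic triangle: comparison with the model plane of constant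
curvature `κ`, which is a rescaled sphere, the Euclidean plane or a rescaled hyperbolic plane. -/
def SatisfiesCAT (κ : ℝ) {X : Type*} [MetricSpace X] (T : GeodesicTriangle X) : Prop :=
  (0 < κ → SatisfiesComparison (sphereDist κ) T) ∧
  (κ = 0 → SatisfiesComparison (fun x y : EuclideanSpace ℝ (Fin 2) => dist x y) T) ∧
  (κ < 0 → SatisfiesComparison (hyperbolicDist κ) T)

/-- `CAT(κ)` spaces. Put `D = π / √κ` if `κ > 0`, and `D = ∞` otherwise. Any two points at
distance less than `D` are joined by a geodesic segment, and every geodesic triangle of perimeter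
less than `2 D` satisfies the `CAT(κ)` inequality. -/
structure IsCAT (κ : ℝ) (X : Type*) [MetricSpace X] : Prop where
  exists_geodesic : ∀ p q : X, (0 < κ → dist p q < Real.pi / √κ) →
    ∃ S : Set X, IsGeodesicSegment S p q
  satisfiesCAT : ∀ T : GeodesicTriangle X, (0 < κ → T.perimeter < 2 * (Real.pi / √κ)) →
    SatisfiesCAT κ T

end CATPT

/-! Pick `m` on the diagonal `x₂x₄` and use `d(x₁,x₃) ≤ d(x₁,m) + d(m,x₃)`. Comparison with the
model plane bounds both summands by the sides of the quadrilateral through a form of Stewart's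
theorem. Placing `m` where the diagonals of a cyclic quadrilateral would meet, the bounds add up to
Ptolemy's inequality, as in `ptolemy_of_division`. For `κ > 0`, `2 sin(√κ d / 2)` is the chord
length in the Euclidean cone over `X`. The chord from `x₂` to `x₄` is divided at a point of radius
`ρ` over some `m`, and a triangle inequality in the cone reduces everything to the Euclidean
estimate. Triangles of large perimeter are not covered by the definition; for them comparison
follows from short subtriangles, which give a local sine-concavity of `cos(√κ d(p,·))` along
geodesics, and from a minimum principle. For `κ < 0` the cone is Lorentzian and its chord lengths
obey no triangle inequality in general, so `cosh(d₁ + d₂)` is estimated directly in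
`hyperbolic_cosh_add_mul_le_of_division`. -/

namespace CATPT

/-! ### Numerical inequalities: from a division point of the diagonal to Ptolemy -/

/-- If every point dividing the diagonal `x₂x₄` in the ratio `τ : 1 - τ` satisfies the Euclidean
comparison inequalities, then Ptolemy's inequality holds (all lengths but `D₁`, `D₂`, `t` are
halved). -/
theorem ptolemy_of_division {a b c d l t : ℝ} (ha : 0 < a) (hb : 0 < b) (hc : 0 < c) (hd : 0 < d)
    (hl : 0 ≤ l)
    (h : ∀ τ ∈ Set.Icc (0 : ℝ) 1, ∃ D₁ D₂ : ℝ, t ≤ D₁ + D₂ ∧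
      D₁ ^ 2 ≤ 4 * ((1 - τ) * a ^ 2 + τ * d ^ 2 - τ * (1 - τ) * l ^ 2) ∧
      D₂ ^ 2 ≤ 4 * ((1 - τ) * b ^ 2 + τ * c ^ 2 - τ * (1 - τ) * l ^ 2)) :
    t * l ≤ 2 * (a * c + b * d) := by
  have hQ : 0 < a * b + c * d := by positivity
  set Q := a * b + c * d with hQdef
  -- The diagonals of a cyclic quadrilateral meet at the point dividing `x₂x₄` in the ratio `ab :
  -- cd`, so this `τ` is sharp in the equality case.
  obtain ⟨D₁, D₂, ht, h₁, h₂⟩ := h (a * b / Q)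
    ⟨by positivity, (div_le_one hQ).2 (by rw [hQdef]; nlinarith [mul_pos hc hd])⟩
  have e : 1 - a * b / Q = c * d / Q := by
    rw [eq_div_iff hQ.ne', sub_mul, div_mul_cancel₀ _ hQ.ne', hQdef]; ring
  set S := (a * c + b * d) * Q with hS
  have k₁ : (D₁ * Q) ^ 2 ≤ 4 * (a * d) * (S - b * c * l ^ 2) := by
    rw [e] at h₁
    have : (D₁ * Q) ^ 2 = D₁ ^ 2 * Q ^ 2 := by ring
    rw [this]
    refine (mul_le_mul_of_nonneg_right h₁ (sq_nonneg Q)).trans (le_of_eq ?_)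
    rw [hS]; field_simp
  have k₂ : (D₂ * Q) ^ 2 ≤ 4 * (b * c) * (S - a * d * l ^ 2) := by
    rw [e] at h₂
    have : (D₂ * Q) ^ 2 = D₂ ^ 2 * Q ^ 2 := by ring
    rw [this]
    refine (mul_le_mul_of_nonneg_right h₂ (sq_nonneg Q)).trans (le_of_eq ?_)
    rw [hS]; field_simp; ring
  have p₁ : 0 ≤ S - b * c * l ^ 2 := by
    by_contra hn
    have : 4 * (a * d) * (S - b * c * l ^ 2) < 0 := mul_neg_of_pos_of_neg (by positivity) (by linarith)
    nlinarith [sq_nonneg (D₁ * Q)]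
  have p₂ : 0 ≤ S - a * d * l ^ 2 := by
    by_contra hn
    have : 4 * (b * c) * (S - a * d * l ^ 2) < 0 := mul_neg_of_pos_of_neg (by positivity) (by linarith)
    nlinarith [sq_nonneg (D₂ * Q)]
  -- AM-GM, weighted so that the `l ^ 2` terms of the two applications cancel in the sum.
  have key : ∀ D u v : ℝ, 0 ≤ u → 0 ≤ v → (D * Q) ^ 2 ≤ 4 * u * v → D * l * Q ≤ u * l ^ 2 + v := by
    intro D u v hu hv hD
    refine abs_le_of_sq_le_sq' ?_ (by positivity) |>.2
    have := mul_le_mul_of_nonneg_right hD (sq_nonneg l)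
    nlinarith [sq_nonneg (u * l ^ 2 - v)]
  have q₁ := key D₁ (a * d) _ (by positivity) p₁ k₁
  have q₂ := key D₂ (b * c) _ (by positivity) p₂ k₂
  have q₃ : t * l * Q ≤ (D₁ + D₂) * l * Q := by gcongr
  have : t * l * Q ≤ 2 * (a * c + b * d) * Q := by rw [hS] at q₁ q₂; linarith
  exact le_of_mul_le_mul_right this hQ

/-- The estimate behind `hyperbolic_ptolemy_of_division`, in terms of the products
`u`, `v` of the sides adjacent to the two other vertices and normalized quantities `x`, `Y`. -/
theorem hyperbolic_cosh_add_mul_le_of_division {u v x Y r d₁ d₂ : ℝ} (hu0 : 0 < u) (hv0 : 0 < v) (hx0 : 0 < x)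
    (hY0 : 0 < Y) (hr : 0 < r) (hd₁ : 0 ≤ d₁) (hd₂ : 0 ≤ d₂)
    (hrr' : r ^ 2 = 1 + 4 * (u * v * x * Y)) (g₁ : r * Real.cosh d₁ ≤ 1 + 2 * (u * Y))
    (g₂ : r * Real.cosh d₂ ≤ 1 + 2 * (v * Y)) : Real.cosh (d₁ + d₂) * x ≤ x + 2 * Y := by
  have c₁ := Real.one_le_cosh d₁
  have c₂ := Real.one_le_cosh d₂
  have s₁ : 0 ≤ Real.sinh d₁ := Real.sinh_nonneg_iff.2 hd₁
  have s₂ : 0 ≤ Real.sinh d₂ := Real.sinh_nonneg_iff.2 hd₂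
  have q₁ : (r * Real.sinh d₁) ^ 2 ≤ 4 * (u * Y) * (1 + u * Y - v * x) := by
    have : (r * Real.sinh d₁) ^ 2 = (r * Real.cosh d₁) ^ 2 - r ^ 2 := by
      rw [mul_pow, Real.sinh_sq]; ring
    rw [this]
    have : (r * Real.cosh d₁) ^ 2 ≤ (1 + 2 * (u * Y)) ^ 2 := by gcongr
    linear_combination this - hrr'
  have q₂ : (r * Real.sinh d₂) ^ 2 ≤ 4 * (v * Y) * (1 + v * Y - u * x) := by
    have : (r * Real.sinh d₂) ^ 2 = (r * Real.cosh d₂) ^ 2 - r ^ 2 := by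
      rw [mul_pow, Real.sinh_sq]; ring
    rw [this]
    have : (r * Real.cosh d₂) ^ 2 ≤ (1 + 2 * (v * Y)) ^ 2 := by gcongr
    linear_combination this - hrr'
  have n₁ : 0 ≤ 1 + u * Y - v * x := by
    by_contra hn
    have : 4 * (u * Y) * (1 + u * Y - v * x) < 0 := mul_neg_of_pos_of_neg (by positivity) (by linarith)
    nlinarith [sq_nonneg (r * Real.sinh d₁)]
  have n₂ : 0 ≤ 1 + v * Y - u * x := by
    by_contra hn
    have : 4 * (v * Y) * (1 + v * Y - u * x) < 0 := mul_neg_of_pos_of_neg (by positivity) (by linarith)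
    nlinarith [sq_nonneg (r * Real.sinh d₂)]
  -- AM-GM on the product of `q₁` and `q₂`, with factors paired so that `4 Y²` comes out.
  have hss : (r * Real.sinh d₁) * (r * Real.sinh d₂) ≤
      2 * Y * (u * (1 + v * Y - u * x) + v * (1 + u * Y - v * x)) := by
    refine abs_le_of_sq_le_sq' ?_ (by positivity) |>.2
    calc ((r * Real.sinh d₁) * (r * Real.sinh d₂)) ^ 2
        = (r * Real.sinh d₁) ^ 2 * (r * Real.sinh d₂) ^ 2 := by ring
      _ ≤ (4 * (u * Y) * (1 + u * Y - v * x)) * (4 * (v * Y) * (1 + v * Y - u * x)) := by gcongr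
      _ = 4 * Y ^ 2 * (4 * (u * (1 + v * Y - u * x)) * (v * (1 + u * Y - v * x))) := by ring
      _ ≤ 4 * Y ^ 2 * (u * (1 + v * Y - u * x) + v * (1 + u * Y - v * x)) ^ 2 := by
          gcongr
          nlinarith [sq_nonneg (u * (1 + v * Y - u * x) - v * (1 + u * Y - v * x))]
      _ = _ := by ring
  have hcc : (r * Real.cosh d₁) * (r * Real.cosh d₂) ≤ (1 + 2 * (u * Y)) * (1 + 2 * (v * Y)) := by
    gcongr
  have hfin : r ^ 2 * Real.cosh (d₁ + d₂) * x ≤ r ^ 2 * (x + 2 * Y) := by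
    have : r ^ 2 * Real.cosh (d₁ + d₂) =
        (r * Real.cosh d₁) * (r * Real.cosh d₂) + (r * Real.sinh d₁) * (r * Real.sinh d₂) := by
      rw [Real.cosh_add]; ring
    rw [this, hrr']
    have h3 := mul_le_mul_of_nonneg_right (add_le_add hcc hss) hx0.le
    -- What the two product bounds leave over is exactly this square.
    have h4 : 0 ≤ 2 * Y * (1 - u * x - v * x) ^ 2 := by positivity
    linear_combination h3 + h4
  refine le_of_mul_le_mul_left ?_ (pow_pos hr 2)
  rwa [← mul_assoc]

/-- The hyperbolic analogue of `ptolemy_of_division`. -/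
theorem hyperbolic_ptolemy_of_division {a b c d l t : ℝ} (ha : 0 < a) (hb : 0 < b) (hc : 0 < c)
    (hd : 0 < d) (hl : 0 < l)
    (h : ∀ τ ∈ Set.Icc (0 : ℝ) 1, ∃ r d₁ d₂ : ℝ, 0 < r ∧ 0 ≤ d₁ ∧ 0 ≤ d₂ ∧
      t ≤ Real.cosh (d₁ + d₂) ∧ r ^ 2 = 1 + 4 * (τ * (1 - τ)) * l ^ 2 ∧
      r * Real.cosh d₁ ≤ 1 + 2 * ((1 - τ) * a ^ 2 + τ * d ^ 2) ∧
      r * Real.cosh d₂ ≤ 1 + 2 * ((1 - τ) * b ^ 2 + τ * c ^ 2)) :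
    (t - 1) * l ^ 2 ≤ 2 * (a * c + b * d) ^ 2 := by
  have hQ : 0 < a * b + c * d := by positivity
  have hP : 0 < a * c + b * d := by positivity
  set Q := a * b + c * d with hQdef
  set P := a * c + b * d with hPdef
  obtain ⟨r, d₁, d₂, hr, hd₁, hd₂, ht, hrr, h₁, h₂⟩ := h (a * b / Q)
    ⟨by positivity, (div_le_one hQ).2 (by rw [hQdef]; nlinarith [mul_pos hc hd])⟩
  have e : 1 - a * b / Q = c * d / Q := by
    rw [eq_div_iff hQ.ne', sub_mul, div_mul_cancel₀ _ hQ.ne', hQdef]; ring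
  -- With these quantities `(1-τ)a² + τd² = uY`, `(1-τ)b² + τc² = vY` and `τ(1-τ)l² = uvxY`.
  obtain ⟨Y, hY⟩ : ∃ Y, Y = P / Q := ⟨_, rfl⟩
  obtain ⟨x, hx⟩ : ∃ x, x = l ^ 2 / (P * Q) := ⟨_, rfl⟩
  obtain ⟨u, hu⟩ : ∃ u, u = a * d := ⟨_, rfl⟩
  obtain ⟨v, hv⟩ : ∃ v, v = b * c := ⟨_, rfl⟩
  have hu0 : 0 < u := hu ▸ by positivity
  have hv0 : 0 < v := hv ▸ by positivity
  have hY0 : 0 < Y := hY ▸ by positivity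
  have hx0 : 0 < x := hx ▸ by positivity
  have hrr' : r ^ 2 = 1 + 4 * (u * v * x * Y) := by
    rw [hrr, e, hu, hv, hx, hY]; field_simp
  have g₁ : r * Real.cosh d₁ ≤ 1 + 2 * (u * Y) := by
    refine h₁.trans (le_of_eq ?_)
    rw [e, hu, hY, hPdef]; field_simp
  have g₂ : r * Real.cosh d₂ ≤ 1 + 2 * (v * Y) := by
    refine h₂.trans (le_of_eq ?_)
    rw [e, hv, hY, hPdef]; field_simp; ring
  have hfin' := hyperbolic_cosh_add_mul_le_of_division hu0 hv0 hx0 hY0 hr hd₁ hd₂ hrr' g₁ g₂ |>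
    le_trans (mul_le_mul_of_nonneg_right ht hx0.le)
  have hxe : x * (P * Q) = l ^ 2 := by rw [hx]; field_simp
  have hYe : Y * (P * Q) = P ^ 2 := by rw [hY]; field_simp
  have := mul_le_mul_of_nonneg_right hfin' (mul_pos hP hQ).le
  linear_combination this + 2 * hYe - (t - 1) * hxe

/-- A weak form of the triangle inequality in the Euclidean cone. -/
theorem two_mul_sin_half_le_cone {t d₁ d₂ r D₁ D₂ : ℝ} (ht0 : 0 ≤ t) (htd : t ≤ d₁ + d₂)
    (hd₁ : d₁ ∈ Set.Icc 0 Real.pi) (hd₂ : d₂ ∈ Set.Icc 0 Real.pi) (hr : 0 ≤ r)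
    (hD₁ : 0 ≤ D₁) (hD₂ : 0 ≤ D₂) (h₁ : D₁ ^ 2 = 1 + r ^ 2 - 2 * r * Real.cos d₁)
    (h₂ : D₂ ^ 2 = 1 + r ^ 2 - 2 * r * Real.cos d₂) : 2 * Real.sin (t / 2) ≤ D₁ + D₂ := by
  rcases le_total (d₁ + d₂) Real.pi with h | h
  · have hmono : Real.sin (t / 2) ≤ Real.sin ((d₁ + d₂) / 2) :=
      Real.sin_le_sin_of_le_of_le_pi_div_two (by linarith [Real.pi_pos]) (by linarith)
        (by linarith)
    refine (mul_le_mul_of_nonneg_left hmono zero_le_two).trans ?_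
    refine abs_le_of_sq_le_sq' ?_ (by positivity) |>.2
    have e : (2 * Real.sin ((d₁ + d₂) / 2)) ^ 2 = 2 - 2 * Real.cos (d₁ + d₂) := by
      rw [mul_pow, Real.sin_sq_eq_half_sub, mul_div_cancel₀ _ two_ne_zero]; ring
    rw [e]
    have e₁ : D₁ ^ 2 = (r - Real.cos d₁) ^ 2 + Real.sin d₁ ^ 2 := by
      rw [h₁, Real.sin_sq]; ring
    have e₂ : D₂ ^ 2 = (r - Real.cos d₂) ^ 2 + Real.sin d₂ ^ 2 := by
      rw [h₂, Real.sin_sq]; ring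
    -- Cauchy-Schwarz in the plane: `D₁`, `D₂` are the distances from `(r, 0)` to unit vectors at
    -- angles `d₁` and `-d₂`.
    have hCS : -((r - Real.cos d₁) * (r - Real.cos d₂)) + Real.sin d₁ * Real.sin d₂ ≤ D₁ * D₂ := by
      refine abs_le_of_sq_le_sq' ?_ (by positivity) |>.2
      rw [mul_pow, e₁, e₂]
      nlinarith [sq_nonneg ((r - Real.cos d₁) * Real.sin d₂ + (r - Real.cos d₂) * Real.sin d₁)]
    rw [Real.cos_add]
    nlinarith
  · have hs := Real.sin_le_one (t / 2)
    have hc : Real.cos d₂ ≤ -Real.cos d₁ := by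
      rw [← Real.cos_pi_sub]
      exact Real.cos_le_cos_of_nonneg_of_le_pi (by linarith [hd₁.2]) hd₂.2 (by linarith)
    -- A distance is at least its projection to the unit direction; since `cos d₁ + cos d₂ ≤ 0`, the
    -- two projections add up to at least `2`.
    have k₁ : 1 - r * Real.cos d₁ ≤ D₁ := by
      refine abs_le_of_sq_le_sq' ?_ hD₁ |>.2
      nlinarith [mul_nonneg (sq_nonneg r) (sq_nonneg (Real.sin d₁)), Real.sin_sq_add_cos_sq d₁]
    have k₂ : 1 - r * Real.cos d₂ ≤ D₂ := by
      refine abs_le_of_sq_le_sq' ?_ hD₂ |>.2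
      nlinarith [mul_nonneg (sq_nonneg r) (sq_nonneg (Real.sin d₂)), Real.sin_sq_add_cos_sq d₂]
    nlinarith [mul_le_mul_of_nonneg_left hc hr]

/-! ### Geodesic triangles and half-angle formulas -/

/-- Comparison between a vertex and a point of the opposite side, unfolded. -/
theorem dist_le_of_comparison {X : Type*} [MetricSpace X] {M : Type*} {δ : M → M → ℝ}
    (hδ : ∀ v, δ v v = 0) {p q r m : X} {S₀ S₁ S₂ : Set X} (h₀ : IsGeodesicSegment S₀ p q)
    (h₁ : IsGeodesicSegment S₁ q r) (h₂ : IsGeodesicSegment S₂ r p) (hm : m ∈ S₁)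
    (hC : ∀ T : GeodesicTriangle X, T.perimeter = dist p q + dist q r + dist r p →
      SatisfiesComparison δ T)
    {v₀ v₁ v₂ m' : M} (e₀ : δ v₀ v₁ = dist p q) (e₁ : δ v₁ v₂ = dist q r)
    (e₂ : δ v₂ v₀ = dist r p) (e₃ : δ v₁ m' = dist q m) (e₄ : δ m' v₂ = dist m r) :
    dist p m ≤ δ v₀ m' := by
  let T : GeodesicTriangle X :=
    { vertex := ![p, q, r]
      side := ![S₀, S₁, S₂]
      isGeodesicSegment_side := by
        intro i
        fin_cases i
        · exact h₀
        · exact h₁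
        · exact h₂ }
  have hp : p ∈ S₀ := by
    obtain ⟨c, hc, -, -, rfl⟩ := h₀
    exact ⟨0, ⟨le_rfl, dist_nonneg⟩, hc⟩
  refine hC T ?_ ![v₀, v₁, v₂] ?_ 0 1 p hp m hm v₀ m' ⟨?_, e₀⟩ ⟨e₃, e₄⟩
  · simp [GeodesicTriangle.perimeter, Fin.sum_univ_three, T]
  · intro i
    fin_cases i
    · exact e₀
    · exact e₁
    · exact e₂
  · exact (hδ v₀).trans (dist_self p).symm

/-- Supplies the short subsegments whose triangles with a given apex have small perimeter. -/
theorem isGeodesicSegment_image_Icc {X : Type*} [MetricSpace X] {c : ℝ → X} {L s t : ℝ}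
    (hc : ∀ s ∈ Set.Icc 0 L, ∀ t ∈ Set.Icc 0 L, dist (c s) (c t) = |s - t|) (hs : 0 ≤ s)
    (hst : s ≤ t) (ht : t ≤ L) : IsGeodesicSegment (c '' Set.Icc s t) (c s) (c t) := by
  have hd : dist (c s) (c t) = t - s := by
    rw [hc s ⟨hs, hst.trans ht⟩ t ⟨hs.trans hst, ht⟩, abs_sub_comm, abs_of_nonneg (by linarith)]
  refine ⟨fun x => c (s + x), by simp, by simp [hd], ?_, ?_⟩
  · rintro x ⟨hx, hx'⟩ y ⟨hy, hy'⟩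
    rw [hd] at hx' hy'
    rw [hc _ ⟨by linarith, by linarith⟩ _ ⟨by linarith, by linarith⟩]
    congr 1
    ring
  · rw [hd]
    ext z
    constructor
    · rintro ⟨x, hx, rfl⟩
      exact ⟨x - s, ⟨by linarith [hx.1], by linarith [hx.2]⟩, by simp⟩
    · rintro ⟨x, hx, rfl⟩
      exact ⟨s + x, ⟨by linarith [hx.1], by linarith [hx.2]⟩, rfl⟩

theorem two_mul_sin_half_sq (x : ℝ) : 2 * Real.sin (x / 2) ^ 2 = 1 - Real.cos x := by
  rw [Real.sin_sq_eq_half_sub, mul_div_cancel₀ _ two_ne_zero]; ring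

theorem two_mul_sinh_half_sq (x : ℝ) : 2 * Real.sinh (x / 2) ^ 2 = Real.cosh x - 1 := by
  have := Real.cosh_two_mul (x / 2)
  rw [mul_div_cancel₀ _ two_ne_zero, Real.cosh_sq] at this
  linarith

/-! ### Comparison with the sphere -/

section Sphere

theorem sphereDist_eq {κ t : ℝ} {x y : Metric.sphere (0 : EuclideanSpace ℝ (Fin 3)) 1}
    (hκ : 0 < κ) (ht : 0 ≤ t) (ht' : √κ * t ≤ Real.pi)
    (h : inner ℝ (x : EuclideanSpace ℝ (Fin 3)) y = Real.cos (√κ * t)) : sphereDist κ x y = t := by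
  have hx : ‖(x : EuclideanSpace ℝ (Fin 3))‖ = 1 := by simp
  have hy : ‖(y : EuclideanSpace ℝ (Fin 3))‖ = 1 := by simp
  have hK := Real.sqrt_pos.2 hκ
  rw [sphereDist, InnerProductGeometry.angle, hx, hy, h, mul_one, div_one,
    Real.arccos_cos (by positivity) ht']
  field_simp

theorem cos_mul_sphereDist {κ : ℝ} (hκ : 0 < κ)
    (x y : Metric.sphere (0 : EuclideanSpace ℝ (Fin 3)) 1) :
    Real.cos (√κ * sphereDist κ x y) = inner ℝ (x : EuclideanSpace ℝ (Fin 3)) y := by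
  have hK := Real.sqrt_pos.2 hκ
  rw [sphereDist, mul_div_cancel₀ _ hK.ne', InnerProductGeometry.cos_angle]
  simp

theorem sphereDist_self (κ : ℝ) (x : Metric.sphere (0 : EuclideanSpace ℝ (Fin 3)) 1) :
    sphereDist κ x x = 0 := by
  have hx : ‖(x : EuclideanSpace ℝ (Fin 3))‖ = 1 := by simp
  rw [sphereDist, InnerProductGeometry.angle_self (by rw [← norm_ne_zero_iff, hx]; simp), zero_div]

/-- A spherical triangle with prescribed side lengths. -/
theorem exists_spherical_triangle {α β l : ℝ}
    (hβ : β ∈ Set.Icc 0 Real.pi) (hl : 0 < l) (hl' : l < Real.pi) (h₁ : α ≤ β + l)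
    (h₂ : β ≤ α + l) (h₃ : l ≤ α + β) (h₄ : α + β + l ≤ 2 * Real.pi) :
    ∃ y z : ℝ, Real.cos α ^ 2 + y ^ 2 + z ^ 2 = 1 ∧
      Real.cos l * Real.cos α + Real.sin l * y = Real.cos β := by
  have hs : 0 < Real.sin l := Real.sin_pos_of_pos_of_lt_pi hl hl'
  have u₁ : Real.cos β ≤ Real.cos (α - l) := by
    rw [← Real.cos_abs (α - l)]
    exact Real.cos_le_cos_of_nonneg_of_le_pi (abs_nonneg _) hβ.2
      (abs_le.2 ⟨by linarith, by linarith⟩)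
  have u₂ : Real.cos (α + l) ≤ Real.cos β := by
    rcases le_total (α + l) Real.pi with h | h
    · exact Real.cos_le_cos_of_nonneg_of_le_pi hβ.1 h h₂
    -- Beyond `π` the cosine increases again, and the perimeter bound replaces `β ≤ α + l`.
    · rw [← Real.cos_two_pi_sub (α + l)]
      exact Real.cos_le_cos_of_nonneg_of_le_pi hβ.1 (by linarith) (by linarith)
  rw [Real.cos_add] at u₂
  rw [Real.cos_sub] at u₁
  set y := (Real.cos β - Real.cos l * Real.cos α) / Real.sin l with hy
  have hy' : Real.sin l * y = Real.cos β - Real.cos l * Real.cos α := by rw [hy]; field_simp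
  have hyα : y ^ 2 ≤ Real.sin α ^ 2 := by
    refine sq_le_sq' ?_ ?_ <;> refine le_of_mul_le_mul_left ?_ hs <;> rw [hy'] <;> linarith
  refine ⟨y, √(Real.sin α ^ 2 - y ^ 2), ?_, by rw [hy']; ring⟩
  rw [Real.sq_sqrt (by linarith), Real.sin_sq]; ring

/-- Equality holds on the sphere: the unit vectors of `q`, `m`, `r` lie on a great circle and
satisfy `sin(qr) m = sin(mr) q + sin(qm) r`; pair this with the vector of `p`. Comparison shortens
`d(p,m)`, hence raises its cosine. -/
theorem IsCAT.spherical_stewart {κ : ℝ} {X : Type*} [MetricSpace X] (hX : IsCAT κ X) (hκ : 0 < κ)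
    {p q r m : X} {S : Set X} (hS : IsGeodesicSegment S q r) (hm : m ∈ S) (hqr : 0 < dist q r)
    (hqm : dist q m + dist m r = dist q r) (hpq : dist p q < Real.pi / √κ)
    (hpr : dist p r < Real.pi / √κ) (hper : dist p q + dist q r + dist r p < 2 * (Real.pi / √κ)) :
    Real.sin (√κ * dist m r) * Real.cos (√κ * dist p q) +
      Real.sin (√κ * dist q m) * Real.cos (√κ * dist p r) ≤
    Real.sin (√κ * dist q r) * Real.cos (√κ * dist p m) := by
  have hK := Real.sqrt_pos.2 hκ
  have lt_pi : ∀ {t : ℝ}, t < Real.pi / √κ → √κ * t < Real.pi := fun h => by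
    rwa [lt_div_iff₀ hK, mul_comm] at h
  have hqr' : dist q r < Real.pi / √κ := by
    have := dist_triangle q p r
    rw [dist_comm q p, dist_comm p r] at this
    linarith
  have l₁ := lt_pi hpq
  have l₂ := lt_pi hpr
  have l₃ := lt_pi hqr'
  obtain ⟨S₀, h₀⟩ := hX.exists_geodesic p q fun _ => hpq
  obtain ⟨S₂, h₂⟩ := hX.exists_geodesic r p fun _ => dist_comm p r ▸ hpr
  have tri : ∀ a b c : X, √κ * dist a b ≤ √κ * dist a c + √κ * dist c b := fun a b c => by
    rw [← mul_add]; exact mul_le_mul_of_nonneg_left (dist_triangle a c b) hK.le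
  obtain ⟨y, z, hyz, hy⟩ := exists_spherical_triangle
    (α := √κ * dist p q) (β := √κ * dist p r) (l := √κ * dist q r)
    ⟨by positivity, l₂.le⟩ (by positivity) l₃
    (by simpa only [dist_comm r q] using tri p q r) (tri p r q)
    (by simpa only [dist_comm q p] using tri q r p)
    (by
      have : dist p q + dist p r + dist q r ≤ 2 * (Real.pi / √κ) := by
        rw [dist_comm p r]; linarith
      have := mul_le_mul_of_nonneg_left this hK.le
      calc _ = √κ * (dist p q + dist p r + dist q r) := by ring
        _ ≤ _ := this
        _ = _ := by field_simp)
  have mem : ∀ a b c : ℝ, a ^ 2 + b ^ 2 + c ^ 2 = 1 →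
      (!₂[a, b, c] : EuclideanSpace ℝ (Fin 3)) ∈ Metric.sphere (0 : EuclideanSpace ℝ (Fin 3)) 1 := by
    intro a b c h
    rw [mem_sphere_zero_iff_norm, EuclideanSpace.norm_eq]
    simp [Fin.sum_univ_three, h]
  have inn : ∀ a b c a' b' c' : ℝ, inner ℝ (!₂[a, b, c] : EuclideanSpace ℝ (Fin 3)) !₂[a', b', c']
      = a * a' + b * b' + c * c' := by
    intro a b c a' b' c'
    simp [PiLp.inner_apply, Fin.sum_univ_three]
    ring
  have hmr : dist m r ≤ dist q r := by linarith [dist_nonneg (x := q) (y := m)]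
  have hqm' : dist q m ≤ dist q r := by linarith [dist_nonneg (x := m) (y := r)]
  have key := dist_le_of_comparison (sphereDist_self κ) h₀ hS h₂ hm
    (fun T hT => (hX.satisfiesCAT T fun _ => hT ▸ hper).1 hκ)
    (v₀ := ⟨_, mem _ y z hyz⟩) (v₁ := ⟨_, mem 1 0 0 (by norm_num)⟩)
    (v₂ := ⟨_, mem (Real.cos (√κ * dist q r)) (Real.sin (√κ * dist q r)) 0 (by simp)⟩)
    (m' := ⟨_, mem (Real.cos (√κ * dist q m)) (Real.sin (√κ * dist q m)) 0 (by simp)⟩)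
    (sphereDist_eq hκ dist_nonneg l₁.le (by simp only [inn]; ring))
    (sphereDist_eq hκ dist_nonneg l₃.le (by simp only [inn]; ring))
    (sphereDist_eq hκ dist_nonneg (dist_comm p r ▸ l₂.le)
      (by simp only [inn]; rw [dist_comm r p, ← hy]; ring))
    (sphereDist_eq hκ dist_nonneg ((mul_le_mul_of_nonneg_left hqm' hK.le).trans l₃.le)
      (by simp only [inn]; ring))
    (sphereDist_eq hκ dist_nonneg ((mul_le_mul_of_nonneg_left hmr hK.le).trans l₃.le)
      (by
        simp only [inn]
        rw [show √κ * dist m r = √κ * dist q r - √κ * dist q m by rw [← hqm]; ring, Real.cos_sub]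
        ring))
  have hcos := Real.cos_le_cos_of_nonneg_of_le_pi (by positivity) (by
    rw [sphereDist, mul_div_cancel₀ _ hK.ne']; exact InnerProductGeometry.angle_le_pi _ _)
    (mul_le_mul_of_nonneg_left key hK.le)
  rw [cos_mul_sphereDist hκ] at hcos
  simp only [inn] at hcos
  have hs : 0 ≤ Real.sin (√κ * dist q r) := Real.sin_nonneg_of_nonneg_of_le_pi (by positivity) l₃.le
  refine le_trans (le_of_eq ?_) (mul_le_mul_of_nonneg_left hcos hs)
  rw [show √κ * dist m r = √κ * dist q r - √κ * dist q m by rw [← hqm]; ring, Real.sin_sub, ← hy]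
  ring

end Sphere

/-! ### Comparison with the Euclidean plane -/

section Euclidean

theorem exists_euclidean_triangle {α β l : ℝ} (hα : 0 ≤ α) (hβ : 0 ≤ β) (hl : 0 < l)
    (h₁ : α ≤ β + l) (h₂ : β ≤ α + l) (h₃ : l ≤ α + β) :
    ∃ x y : ℝ, x ^ 2 + y ^ 2 = α ^ 2 ∧ (l - x) ^ 2 + y ^ 2 = β ^ 2 := by
  set x := (α ^ 2 + l ^ 2 - β ^ 2) / (2 * l) with hx
  have hx' : 2 * l * x = α ^ 2 + l ^ 2 - β ^ 2 := by rw [hx]; field_simp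
  have hxα : x ^ 2 ≤ α ^ 2 := by
    refine sq_le_sq' ?_ ?_ <;>
      refine le_of_mul_le_mul_left ?_ (show 0 < 2 * l by positivity) <;> rw [hx'] <;> nlinarith
  refine ⟨x, √(α ^ 2 - x ^ 2), ?_, ?_⟩ <;> rw [Real.sq_sqrt (by linarith)]
  · ring
  · linear_combination -hx'

theorem IsCAT.euclidean_stewart {X : Type*} [MetricSpace X] (hX : IsCAT 0 X)
    {p q r m : X} {S : Set X} (hS : IsGeodesicSegment S q r) (hm : m ∈ S) (hqr : 0 < dist q r)
    {τ : ℝ} (hτ : τ ∈ Set.Icc (0 : ℝ) 1)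
    (hqm : dist q m = τ * dist q r) (hmr : dist m r = (1 - τ) * dist q r) :
    dist p m ^ 2 ≤ (1 - τ) * dist p q ^ 2 + τ * dist p r ^ 2 - τ * (1 - τ) * dist q r ^ 2 := by
  obtain ⟨S₀, h₀⟩ := hX.exists_geodesic p q fun h => (lt_irrefl _ h).elim
  obtain ⟨S₂, h₂⟩ := hX.exists_geodesic r p fun h => (lt_irrefl _ h).elim
  obtain ⟨x, y, hx, hy⟩ := exists_euclidean_triangle
    (α := dist p q) (β := dist p r) (l := dist q r) dist_nonneg dist_nonneg hqr
    (by simpa only [dist_comm r q] using dist_triangle p r q) (dist_triangle p q r)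
    (by simpa only [dist_comm q p] using dist_triangle q p r)
  have dis : ∀ a b a' b' : ℝ, dist (!₂[a, b] : EuclideanSpace ℝ (Fin 2)) !₂[a', b'] =
      √((a - a') ^ 2 + (b - b') ^ 2) := by
    intro a b a' b'
    simp [EuclideanSpace.dist_eq, Real.dist_eq, sq_abs]
  have key := dist_le_of_comparison (δ := fun x y : EuclideanSpace ℝ (Fin 2) => dist x y)
    dist_self h₀ hS h₂ hm
    (fun T _ => (hX.satisfiesCAT T fun h => (lt_irrefl _ h).elim).2.1 rfl)
    (v₀ := !₂[x, y]) (v₁ := !₂[0, 0]) (v₂ := !₂[dist q r, 0]) (m' := !₂[τ * dist q r, 0])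
    (by simp only [dis, sub_zero]; rw [hx, Real.sqrt_sq dist_nonneg])
    (by simp only [dis]; simp)
    (by simp only [dis]; rw [zero_sub, neg_sq, hy, Real.sqrt_sq dist_nonneg, dist_comm])
    (by simp only [dis]; rw [hqm]; simp [Real.sqrt_sq (mul_nonneg hτ.1 hqr.le)])
    (by
      simp only [dis]; rw [hmr, sub_zero, zero_pow two_ne_zero, add_zero, Real.sqrt_sq_eq_abs,
        abs_sub_comm, abs_of_nonneg (by nlinarith [hτ.2])]
      ring)
  simp only [dis] at key
  refine (pow_le_pow_left₀ dist_nonneg key 2).trans (le_of_eq ?_)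
  rw [Real.sq_sqrt (by positivity)]
  linear_combination (1 - τ) * hx + τ * hy

end Euclidean

/-! ### Comparison with the hyperbolic plane -/

section Hyperbolic

/-- A hyperbolic triangle with prescribed side lengths, in coordinates of the upper half plane
for which one side lies on the imaginary axis. -/
theorem exists_hyperbolic_triangle {α β l : ℝ} (hα : 0 ≤ α) (hβ : 0 ≤ β) (hl : 0 < l)
    (h₁ : α ≤ β + l) (h₂ : β ≤ α + l) (h₃ : l ≤ α + β) :
    ∃ x y : ℝ, 0 < y ∧ x ^ 2 + y ^ 2 + 1 = 2 * y * Real.cosh α ∧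
      (x ^ 2 + y ^ 2) * Real.exp (-l) + Real.exp l = 2 * y * Real.cosh β := by
  have hs : 0 < Real.sinh l := Real.sinh_pos_iff.2 hl
  have u₁ : Real.cosh (α - l) ≤ Real.cosh β := by
    rw [Real.cosh_le_cosh, abs_of_nonneg hβ]
    exact abs_le.2 ⟨by linarith, by linarith⟩
  have u₂ : Real.cosh β ≤ Real.cosh (α + l) := by
    rw [Real.cosh_le_cosh, abs_of_nonneg hβ, abs_of_nonneg (by linarith)]
    linarith
  rw [Real.cosh_sub] at u₁
  rw [Real.cosh_add] at u₂
  have sc : Real.sinh α < Real.cosh α := Real.sinh_lt_cosh α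
  have hα' := Real.sinh_nonneg_iff.2 hα
  have ea := Real.cosh_sq α
  have el := Real.cosh_sq l
  -- Here `B = 1 / (2y)`. Dividing both equations by `2y` makes them linear in `B` and `(x² + y²) /
  -- (2y) = cosh α - B`.
  obtain ⟨B, hB⟩ : ∃ B, 2 * Real.sinh l * B =
      Real.cosh β - (Real.cosh l - Real.sinh l) * Real.cosh α :=
    ⟨(Real.cosh β - (Real.cosh l - Real.sinh l) * Real.cosh α) / (2 * Real.sinh l), by field_simp⟩
  have hB0 : 0 < B := by
    have : 0 < 2 * Real.sinh l * B := by
      rw [hB]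
      nlinarith
    exact pos_of_mul_pos_right this (by positivity)
  -- This is the condition `x² ≥ 0` in terms of `B`.
  have hAB : 1 ≤ 4 * B * (Real.cosh α - B) := by
    have : 0 ≤ (Real.sinh l * Real.sinh α) ^ 2 - (Real.cosh l * Real.cosh α - Real.cosh β) ^ 2 := by
      rw [sub_nonneg]
      exact sq_le_sq' (by linarith) (by linarith)
    refine le_of_mul_le_mul_left ?_ (pow_pos hs 2)
    nlinarith
  set y := 1 / (2 * B) with hy
  have hyB : 2 * y * B = 1 := by rw [hy]; field_simp
  have hy0 : 0 < y := by positivity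
  have hxx : 0 ≤ 2 * y * (Real.cosh α - B) - y ^ 2 := by
    have := mul_le_mul_of_nonneg_left hAB (sq_nonneg y)
    have e : y ^ 2 * (4 * B * (Real.cosh α - B)) = 2 * y * (Real.cosh α - B) * (2 * y * B) := by
      ring
    rw [e, hyB] at this
    linarith
  refine ⟨√(2 * y * (Real.cosh α - B) - y ^ 2), y, hy0, ?_, ?_⟩ <;> rw [Real.sq_sqrt hxx]
  · linear_combination -hyB
  · rw [← Real.cosh_sub_sinh, ← Real.cosh_add_sinh]
    linear_combination 2 * y * hB - (Real.cosh l + Real.sinh l) * hyB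

theorem hyperbolicDist_eq {κ t : ℝ} {z w : UpperHalfPlane} (hκ : κ < 0) (ht : 0 ≤ t)
    (h : (z.re - w.re) ^ 2 + z.im ^ 2 + w.im ^ 2 = 2 * z.im * w.im * Real.cosh (√(-κ) * t)) :
    hyperbolicDist κ z w = t := by
  have hK := Real.sqrt_pos.2 (neg_pos.2 hκ)
  have hz := z.im_pos
  have hw := w.im_pos
  have : Real.cosh (dist z w) = Real.cosh (√(-κ) * t) := by
    rw [UpperHalfPlane.cosh_dist', h]; field_simp
  rw [hyperbolicDist, Real.cosh_injOn (Set.mem_Ici.2 dist_nonneg)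
    (Set.mem_Ici.2 (by positivity)) this]
  field_simp

theorem hyperbolicDist_self (κ : ℝ) (z : UpperHalfPlane) : hyperbolicDist κ z z = 0 := by
  simp [hyperbolicDist]

/-- Equality holds in the model: with `qr` on the imaginary axis, `cosh` of the distance from a
fixed point to `i eˢ` is a combination of `eˢ` and `e⁻ˢ`, hence is interpolated from two values with
`sinh` weights. -/
theorem IsCAT.hyperbolic_stewart {κ : ℝ} {X : Type*} [MetricSpace X] (hX : IsCAT κ X)
    (hκ : κ < 0) {p q r m : X} {S : Set X} (hS : IsGeodesicSegment S q r) (hm : m ∈ S)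
    (hqr : 0 < dist q r) (hqm : dist q m + dist m r = dist q r) :
    Real.sinh (√(-κ) * dist q r) * Real.cosh (√(-κ) * dist p m) ≤
      Real.sinh (√(-κ) * dist m r) * Real.cosh (√(-κ) * dist p q) +
        Real.sinh (√(-κ) * dist q m) * Real.cosh (√(-κ) * dist p r) := by
  have hK := Real.sqrt_pos.2 (neg_pos.2 hκ)
  obtain ⟨S₀, h₀⟩ := hX.exists_geodesic p q fun h => (lt_asymm h hκ).elim
  obtain ⟨S₂, h₂⟩ := hX.exists_geodesic r p fun h => (lt_asymm h hκ).elim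
  have tri : ∀ a b c : X, √(-κ) * dist a b ≤ √(-κ) * dist a c + √(-κ) * dist c b := fun a b c => by
    rw [← mul_add]; exact mul_le_mul_of_nonneg_left (dist_triangle a c b) hK.le
  obtain ⟨x, y, hy, e₁, e₂⟩ := exists_hyperbolic_triangle
    (α := √(-κ) * dist p q) (β := √(-κ) * dist p r) (l := √(-κ) * dist q r)
    (by positivity) (by positivity) (by positivity)
    (by simpa only [dist_comm r q] using tri p q r) (tri p r q)
    (by simpa only [dist_comm q p] using tri q r p)
  have hsub : √(-κ) * dist m r = √(-κ) * dist q r - √(-κ) * dist q m := by rw [← hqm]; ring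
  have key := dist_le_of_comparison (hyperbolicDist_self κ) h₀ hS h₂ hm
    (fun T _ => (hX.satisfiesCAT T fun h => (lt_asymm h hκ).elim).2.2 hκ)
    (v₀ := ⟨⟨x, y⟩, hy⟩) (v₁ := ⟨⟨0, 1⟩, one_pos⟩)
    (v₂ := ⟨⟨0, Real.exp (√(-κ) * dist q r)⟩, Real.exp_pos _⟩)
    (m' := ⟨⟨0, Real.exp (√(-κ) * dist q m)⟩, Real.exp_pos _⟩)
    (hyperbolicDist_eq hκ dist_nonneg (by
      simp only [UpperHalfPlane.re, UpperHalfPlane.im]; linear_combination e₁))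
    (hyperbolicDist_eq hκ dist_nonneg (by
      simp only [UpperHalfPlane.re, UpperHalfPlane.im]
      rw [Real.cosh_eq, Real.exp_neg]; field_simp; ring))
    (hyperbolicDist_eq hκ dist_nonneg (by
      simp only [UpperHalfPlane.re, UpperHalfPlane.im]
      rw [dist_comm r p]
      have e := Real.exp_ne_zero (√(-κ) * dist q r)
      rw [Real.exp_neg] at e₂
      field_simp at e₂
      linear_combination e₂))
    (hyperbolicDist_eq hκ dist_nonneg (by
      simp only [UpperHalfPlane.re, UpperHalfPlane.im]
      rw [Real.cosh_eq, Real.exp_neg]; field_simp; ring))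
    (hyperbolicDist_eq hκ dist_nonneg (by
      simp only [UpperHalfPlane.re, UpperHalfPlane.im]
      rw [hsub, Real.cosh_eq, neg_sub, Real.exp_sub, Real.exp_sub]; field_simp; ring))
  have hs : 0 ≤ Real.sinh (√(-κ) * dist q r) := Real.sinh_nonneg_iff.2 (by positivity)
  have hcosh := mul_le_mul_of_nonneg_left key hK.le
  rw [hyperbolicDist, mul_div_cancel₀ _ hK.ne', ← abs_of_nonneg (by positivity : 0 ≤ √(-κ) * _),
    ← abs_of_nonneg (dist_nonneg (α := UpperHalfPlane)), ← Real.cosh_le_cosh,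
    UpperHalfPlane.cosh_dist'] at hcosh
  simp only [UpperHalfPlane.re, UpperHalfPlane.im] at hcosh
  refine (mul_le_mul_of_nonneg_left hcosh hs).trans (le_of_eq ?_)
  have f₁ : Real.cosh (√(-κ) * dist p q) = (x ^ 2 + y ^ 2 + 1) / (2 * y) := by
    rw [e₁]; field_simp
  have f₂ : Real.cosh (√(-κ) * dist p r) = ((x ^ 2 + y ^ 2) * Real.exp (-(√(-κ) * dist q r)) +
      Real.exp (√(-κ) * dist q r)) / (2 * y) := by
    rw [e₂]; field_simp
  rw [f₁, f₂, hsub]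
  simp only [Real.sinh_eq, neg_sub, Real.exp_sub, Real.exp_neg]
  field_simp
  ring

end Hyperbolic

/-! ### Sine-concave functions -/

/-- A minimum principle for locally sine-concave functions. -/
theorem nonneg_of_locally_sin_concave {K L : ℝ} (hK : 0 < K) (hKL : K * L < Real.pi) {h : ℝ → ℝ}
    (hc : ContinuousOn h (Set.Icc 0 L)) (h₀ : 0 ≤ h 0) (h₁ : 0 ≤ h L)
    (hloc : ∀ s ∈ Set.Ioo 0 L, ∃ δ > 0, δ ≤ s ∧ s + δ ≤ L ∧
      h (s - δ) + h (s + δ) ≤ 2 * Real.cos (K * δ) * h s) {s : ℝ} (hs : s ∈ Set.Icc 0 L) :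
    0 ≤ h s := by
  -- A positive function with equality in the concavity condition (`hφadd`); positivity uses `K * L
  -- < π`.
  set φ : ℝ → ℝ := fun s => Real.cos (K * (s - L / 2)) with hφ
  have φpos : ∀ s ∈ Set.Icc 0 L, 0 < φ s := fun s hs =>
    Real.cos_pos_of_mem_Ioo ⟨by nlinarith [hs.1, hs.2], by nlinarith [hs.1, hs.2]⟩
  have φc : ContinuousOn φ (Set.Icc 0 L) := by fun_prop
  have kc : ContinuousOn (fun s => h s / φ s) (Set.Icc 0 L) :=
    hc.div φc fun s hs => (φpos s hs).ne'
  obtain ⟨s₁, hs₁, hmin⟩ := isCompact_Icc.exists_isMinOn ⟨s, hs⟩ kc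
  by_contra hneg
  have hk : h s₁ / φ s₁ < 0 := (hmin hs).trans_lt (div_neg_of_neg_of_pos (not_le.1 hneg) (φpos s hs))
  set k := h s₁ / φ s₁ with hkdef
  have hle : ∀ s ∈ Set.Icc 0 L, k * φ s ≤ h s := fun s hs => (le_div_iff₀ (φpos s hs)).1 (hmin hs)
  -- The leftmost minimizer of `h / φ`. A single `δ` at this point suffices: concavity makes `t - δ`
  -- a minimizer too, a contradiction.
  obtain ⟨t, ⟨ht, htk⟩, hleast⟩ := (isCompact_Icc.of_isClosed_subset
    (kc.preimage_isClosed_of_isClosed isClosed_Icc (isClosed_Iic (a := k)))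
    Set.inter_subset_left).exists_isLeast ⟨s₁, hs₁, (le_refl k : _)⟩
  have htk' : h t ≤ k * φ t := (div_le_iff₀ (φpos t ht)).1 htk
  have hlt : h t < 0 := htk'.trans_lt (mul_neg_of_neg_of_pos hk (φpos t ht))
  have t0 : 0 < t := lt_of_le_of_ne ht.1 fun e => by rw [← e] at hlt; linarith
  have tL : t < L := lt_of_le_of_ne ht.2 fun e => by rw [e] at hlt; linarith
  obtain ⟨δ, hδ, hδt, hδL, hsum⟩ := hloc t ⟨t0, tL⟩
  have m₁ : t - δ ∈ Set.Icc 0 L := ⟨by linarith, by linarith⟩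
  have m₂ : t + δ ∈ Set.Icc 0 L := ⟨by linarith, hδL⟩
  have hφadd : φ (t - δ) + φ (t + δ) = 2 * Real.cos (K * δ) * φ t := by
    simp only [hφ]
    rw [show K * (t - δ - L / 2) = K * (t - L / 2) - K * δ by ring,
      show K * (t + δ - L / 2) = K * (t - L / 2) + K * δ by ring, Real.cos_sub, Real.cos_add]
    ring
  have hcos : 0 ≤ Real.cos (K * δ) :=
    Real.cos_nonneg_of_mem_Icc ⟨by nlinarith [Real.pi_pos], by nlinarith⟩
  have : h (t - δ) ≤ k * φ (t - δ) := by
    have a₁ := hle _ m₂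
    have a₂ := mul_le_mul_of_nonneg_left htk' (mul_nonneg zero_le_two hcos)
    have a₃ : k * (φ (t - δ) + φ (t + δ)) = 2 * Real.cos (K * δ) * (k * φ t) := by rw [hφadd]; ring
    linarith
  have := hleast ⟨m₁, (div_le_iff₀ (φpos _ m₁)).2 this⟩
  linarith

/-! ### The case `κ > 0`: large triangles, the Euclidean cone, Ptolemy -/

section Sphere

variable {κ : ℝ} {X : Type*} [MetricSpace X]

/-- The comparison inequality for midpoints of short subsegments, for triangles of arbitrary
perimeter. -/
theorem IsCAT.exists_local_sin_concave (hX : IsCAT κ X) (hκ : 0 < κ)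
    (hdiam : ∀ x y : X, dist x y ≤ Real.pi / √κ) {c : ℝ → X} {L : ℝ}
    (hc : ∀ s ∈ Set.Icc 0 L, ∀ t ∈ Set.Icc 0 L, dist (c s) (c t) = |s - t|)
    (hL : L < Real.pi / √κ) (p : X) {s : ℝ} (hs : s ∈ Set.Ioo 0 L) :
    ∃ δ > 0, δ ≤ s ∧ s + δ ≤ L ∧ Real.cos (√κ * dist p (c (s - δ))) +
      Real.cos (√κ * dist p (c (s + δ))) ≤ 2 * Real.cos (√κ * δ) * Real.cos (√κ * dist p (c s)) := by
  have hK := Real.sqrt_pos.2 hκ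
  obtain ⟨hs0, hsL⟩ := hs
  have le_pi : ∀ x y : X, √κ * dist x y ≤ Real.pi := fun x y => by
    rw [mul_comm, ← le_div_iff₀ hK]; exact hdiam x y
  have hd : ∀ δ, 0 < δ → δ ≤ s → s + δ ≤ L → dist (c s) (c (s - δ)) = δ ∧
      dist (c s) (c (s + δ)) = δ ∧ dist (c (s - δ)) (c (s + δ)) = 2 * δ := by
    intro δ h0 h1 h2
    have m₀ : s ∈ Set.Icc 0 L := ⟨hs0.le, hsL.le⟩
    have m₁ : s - δ ∈ Set.Icc 0 L := ⟨by linarith, by linarith⟩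
    have m₂ : s + δ ∈ Set.Icc 0 L := ⟨by linarith, h2⟩
    rw [hc _ m₀ _ m₁, hc _ m₀ _ m₂, hc _ m₁ _ m₂]
    refine ⟨?_, ?_, ?_⟩
    · rw [abs_of_nonneg] <;> linarith
    · rw [abs_of_nonpos] <;> linarith
    · rw [abs_of_nonpos] <;> linarith
  -- If `p` and `c s` are at distance `π / √κ`, no short triangle is available, but the triangle
  -- inequality alone gives the estimate.
  rcases (hdiam p (c s)).eq_or_lt with he | he
  · obtain ⟨δ, hδ, h1, h2⟩ : ∃ δ > 0, δ ≤ s ∧ s + δ ≤ L :=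
      ⟨min s (L - s), lt_min hs0 (by linarith), min_le_left _ _, by linarith [min_le_right s (L - s)]⟩
    obtain ⟨d₁, d₂, -⟩ := hd δ hδ h1 h2
    have hδπ : √κ * δ ≤ Real.pi := by
      rw [mul_comm, ← le_div_iff₀ hK]; linarith
    have hpi : √κ * dist p (c s) = Real.pi := by rw [he]; field_simp
    have far : ∀ x : X, dist (c s) x = δ → Real.cos (√κ * dist p x) ≤ -Real.cos (√κ * δ) := by
      intro x hx
      rw [← Real.cos_pi_sub]
      refine Real.cos_le_cos_of_nonneg_of_le_pi (by linarith) (le_pi _ _) ?_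
      have := mul_le_mul_of_nonneg_left (dist_triangle p x (c s)) hK.le
      rw [dist_comm x, hx, hpi] at this
      linarith
    refine ⟨δ, hδ, h1, h2, ?_⟩
    rw [hpi, Real.cos_pi]
    linarith [far _ d₁, far _ d₂]
  -- With `d = d(p, c s)` the perimeter is at most `2d + 4δ`, which this `δ` keeps below `2π / √κ`.
  · obtain ⟨δ, hδ, h1, h2, h3⟩ : ∃ δ > 0, δ ≤ s ∧ s + δ ≤ L ∧
        δ ≤ (Real.pi / √κ - dist p (c s)) / 3 := by
      obtain ⟨δ, hδ, h⟩ := exists_between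
        (lt_min (lt_min hs0 (sub_pos.2 hsL)) (div_pos (sub_pos.2 he) zero_lt_three))
      rw [lt_min_iff, lt_min_iff] at h
      exact ⟨δ, hδ, h.1.1.le, by linarith [h.1.2], h.2.le⟩
    obtain ⟨d₁, d₂, d₃⟩ := hd δ hδ h1 h2
    have t₁ := dist_triangle p (c s) (c (s - δ))
    have t₂ := dist_triangle p (c s) (c (s + δ))
    have key := hX.spherical_stewart hκ (p := p)
      (isGeodesicSegment_image_Icc hc (by linarith : 0 ≤ s - δ) (by linarith : s - δ ≤ s + δ) h2)
      ⟨s, ⟨by linarith, by linarith⟩, rfl⟩ (by rw [d₃]; positivity)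
      (by rw [d₃, dist_comm, d₁, d₂]; ring) (by linarith) (by linarith)
      (by rw [dist_comm _ p]; linarith)
    rw [d₂, dist_comm _ (c s), d₁, d₃, show √κ * (2 * δ) = 2 * (√κ * δ) by ring, Real.sin_two_mul,
      ← mul_add] at key
    have hsin : 0 < Real.sin (√κ * δ) := Real.sin_pos_of_pos_of_lt_pi (by positivity) (by
      rw [mul_comm, ← lt_div_iff₀ hK]; linarith)
    refine ⟨δ, hδ, h1, h2, le_of_mul_le_mul_left ?_ hsin⟩
    linarith

/-- Comparison in a `CAT(κ)` space of diameter at most `π / √κ`, for triangles of arbitrary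
perimeter. -/
theorem IsCAT.spherical_stewart_of_diam (hX : IsCAT κ X) (hκ : 0 < κ)
    (hdiam : ∀ x y : X, dist x y ≤ Real.pi / √κ) {c : ℝ → X} {L : ℝ}
    (hc : ∀ s ∈ Set.Icc 0 L, ∀ t ∈ Set.Icc 0 L, dist (c s) (c t) = |s - t|)
    (hL : L < Real.pi / √κ) (p : X) {s : ℝ} (hs : s ∈ Set.Icc 0 L) :
    Real.sin (√κ * (L - s)) * Real.cos (√κ * dist p (c 0)) +
      Real.sin (√κ * s) * Real.cos (√κ * dist p (c L)) ≤
    Real.sin (√κ * L) * Real.cos (√κ * dist p (c s)) := by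
  have hK := Real.sqrt_pos.2 hκ
  have hKL : √κ * L < Real.pi := by rwa [mul_comm, ← lt_div_iff₀ hK]
  have hL0 : 0 ≤ L := hs.1.trans hs.2
  have hsinL : 0 ≤ Real.sin (√κ * L) := Real.sin_nonneg_of_nonneg_of_le_pi (by positivity) hKL.le
  have cc : ContinuousOn c (Set.Icc 0 L) :=
    (LipschitzOnWith.of_dist_le_mul (K := 1) fun x hx y hy => by
      rw [hc x hx y hy, NNReal.coe_one, one_mul, Real.dist_eq]).continuousOn
  -- The subtracted sine interpolation satisfies the concavity condition with equality and agrees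
  -- with the first term at both ends.
  have := nonneg_of_locally_sin_concave hK hKL
    (h := fun s => Real.sin (√κ * L) * Real.cos (√κ * dist p (c s)) -
      (Real.sin (√κ * (L - s)) * Real.cos (√κ * dist p (c 0)) +
      Real.sin (√κ * s) * Real.cos (√κ * dist p (c L)))) (by fun_prop) (by simp) (by simp) ?_ hs
  · exact sub_nonneg.1 this
  · intro t ht
    obtain ⟨δ, h0, h1, h2, h3⟩ := hX.exists_local_sin_concave hκ hdiam hc hL p ht
    refine ⟨δ, h0, h1, h2, ?_⟩
    have h4 := mul_le_mul_of_nonneg_left h3 hsinL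
    rw [show √κ * (L - (t - δ)) = √κ * (L - t) + √κ * δ by ring,
      show √κ * (L - (t + δ)) = √κ * (L - t) - √κ * δ by ring,
      show √κ * (t - δ) = √κ * t - √κ * δ by ring,
      show √κ * (t + δ) = √κ * t + √κ * δ by ring]
    simp only [Real.sin_sub, Real.sin_add]
    linear_combination h4

/-- The point of the Euclidean cone over `X` dividing the chord from `q` to `r` in the ratio
`τ : 1 - τ`. -/
theorem IsCAT.exists_cone_division (hX : IsCAT κ X) (hκ : 0 < κ)
    (hdiam : ∀ x y : X, dist x y ≤ Real.pi / √κ) (q r : X) {τ : ℝ} (hτ : τ ∈ Set.Icc (0 : ℝ) 1) :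
    ∃ (m : X) (ρ : ℝ), 0 ≤ ρ ∧ ρ ^ 2 = (1 - τ) ^ 2 + τ ^ 2 +
        2 * τ * (1 - τ) * Real.cos (√κ * dist q r) ∧
      ∀ p, (1 - τ) * Real.cos (√κ * dist p q) + τ * Real.cos (√κ * dist p r) ≤
        ρ * Real.cos (√κ * dist p m) := by
  have hK := Real.sqrt_pos.2 hκ
  obtain ⟨hτ0, hτ1⟩ := hτ
  have hτ1' := sub_nonneg.2 hτ1
  rcases (hdiam q r).eq_or_lt with he | he
  · have hpi : √κ * dist q r = Real.pi := by rw [he]; field_simp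
    have anti : ∀ p, Real.cos (√κ * dist p q) + Real.cos (√κ * dist p r) ≤ 0 := by
      intro p
      have h1 : Real.pi ≤ √κ * dist p q + √κ * dist p r := by
        rw [← hpi, ← mul_add, dist_comm p q]
        exact mul_le_mul_of_nonneg_left (dist_triangle _ _ _) hK.le
      have h2 : √κ * dist p r ≤ Real.pi := by
        rw [mul_comm, ← le_div_iff₀ hK]; exact hdiam _ _
      have h3 : √κ * dist p q ≤ Real.pi := by
        rw [mul_comm, ← le_div_iff₀ hK]; exact hdiam _ _
      have := Real.cos_le_cos_of_nonneg_of_le_pi (by linarith : 0 ≤ Real.pi - √κ * dist p q) h2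
        (by linarith)
      rw [Real.cos_pi_sub] at this
      linarith
    rw [hpi, Real.cos_pi]
    -- At distance `π / √κ` the chord runs through the apex of the cone, so its points lie over `q`
    -- or over `r`.
    rcases le_total τ (1 / 2) with h | h
    · exact ⟨q, 1 - 2 * τ, by linarith, by ring, fun p => by nlinarith [anti p]⟩
    · exact ⟨r, 2 * τ - 1, by linarith, by ring, fun p => by nlinarith [anti p]⟩
  rcases (dist_nonneg (x := q) (y := r)).eq_or_lt with h0 | h0
  · rw [← h0, eq_of_dist_eq_zero h0.symm]
    exact ⟨r, 1, zero_le_one, by simp; ring, fun p => by linarith⟩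
  obtain ⟨S, c, c0, cL, hc, -⟩ := hX.exists_geodesic q r fun _ => he
  set L := dist q r with hL
  have hKL : √κ * L < Real.pi := by rwa [mul_comm, ← lt_div_iff₀ hK]
  have hsinL : 0 < Real.sin (√κ * L) := Real.sin_pos_of_pos_of_lt_pi (by positivity) hKL
  -- Direction of the chord point: the components of `(1-τ)q` and `τr` transverse to `c s` cancel.
  -- The components along `c s` add up to the radius `ρ`.
  obtain ⟨s, hs, hs'⟩ : ∃ s ∈ Set.Icc 0 L,
      (1 - τ) * Real.sin (√κ * s) - τ * Real.sin (√κ * (L - s)) = 0 := by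
    refine intermediate_value_Icc h0.le (f := fun s => (1 - τ) * Real.sin (√κ * s) -
      τ * Real.sin (√κ * (L - s))) (by fun_prop) ⟨?_, ?_⟩
    · simp; positivity
    · simp; positivity
  set ρ := (1 - τ) * Real.cos (√κ * s) + τ * Real.cos (√κ * (L - s)) with hρ
  have e : Real.sin (√κ * L) = Real.sin (√κ * s) * Real.cos (√κ * (L - s)) +
      Real.cos (√κ * s) * Real.sin (√κ * (L - s)) := by
    rw [← Real.sin_add]; ring_nf
  have e' : Real.cos (√κ * L) = Real.cos (√κ * s) * Real.cos (√κ * (L - s)) -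
      Real.sin (√κ * s) * Real.sin (√κ * (L - s)) := by
    rw [← Real.cos_add]; ring_nf
  have k₁ : ρ * Real.sin (√κ * (L - s)) = (1 - τ) * Real.sin (√κ * L) := by
    rw [hρ, e]; linear_combination -Real.cos (√κ * (L - s)) * hs'
  have k₂ : ρ * Real.sin (√κ * s) = τ * Real.sin (√κ * L) := by
    rw [hρ, e]; linear_combination Real.cos (√κ * s) * hs'
  have hρ0 : 0 ≤ ρ := by
    have n₁ : 0 ≤ Real.sin (√κ * (L - s)) := Real.sin_nonneg_of_nonneg_of_le_pi
      (mul_nonneg hK.le (by linarith [hs.2])) (by nlinarith [hs.1])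
    have n₂ : 0 ≤ Real.sin (√κ * s) := Real.sin_nonneg_of_nonneg_of_le_pi
      (mul_nonneg hK.le hs.1) (by nlinarith [hs.2])
    by_contra hn
    nlinarith
  refine ⟨c s, ρ, hρ0, ?_, fun p => ?_⟩
  · rw [e', hρ]
    linear_combination (-hs') * ((1 - τ) * Real.sin (√κ * s) - τ * Real.sin (√κ * (L - s))) +
      (1 - τ) ^ 2 * Real.sin_sq_add_cos_sq (√κ * s) + τ ^ 2 * Real.sin_sq_add_cos_sq (√κ * (L - s))
  · have key := mul_le_mul_of_nonneg_left
      (hX.spherical_stewart_of_diam hκ hdiam hc he p hs) hρ0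
    rw [c0, cL] at key
    refine le_of_mul_le_mul_left ?_ hsinL
    linear_combination key - Real.cos (√κ * dist p q) * k₁ - Real.cos (√κ * dist p r) * k₂

/-- Euclidean Ptolemy for chords of the cone: the `D₁`, `D₂` supplied are the cone distances from
`x₁`, `x₃` to the point of radius `ρ` over `m`. -/
theorem IsCAT.spherical_ptolemy (hX : IsCAT κ X) (hκ : 0 < κ)
    (hdiam : ∀ x y : X, dist x y ≤ Real.pi / √κ) {x₁ x₂ x₃ x₄ : X} (h₁₂ : x₁ ≠ x₂)
    (h₂₃ : x₂ ≠ x₃) (h₃₄ : x₃ ≠ x₄) (h₁₄ : x₁ ≠ x₄) :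
    Real.sin (√κ * dist x₁ x₃ / 2) * Real.sin (√κ * dist x₂ x₄ / 2) ≤
      Real.sin (√κ * dist x₁ x₂ / 2) * Real.sin (√κ * dist x₃ x₄ / 2) +
        Real.sin (√κ * dist x₁ x₄ / 2) * Real.sin (√κ * dist x₂ x₃ / 2) := by
  have hK := Real.sqrt_pos.2 hκ
  have le_pi : ∀ x y : X, √κ * dist x y ≤ Real.pi := fun x y => by
    rw [mul_comm, ← le_div_iff₀ hK]; exact hdiam x y
  have pos : ∀ {x y : X}, x ≠ y → 0 < Real.sin (√κ * dist x y / 2) := fun {x y} h => by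
    have := dist_pos.2 h
    exact Real.sin_pos_of_pos_of_lt_pi (by positivity) (by linarith [le_pi x y, Real.pi_pos])
  have := ptolemy_of_division (t := 2 * Real.sin (√κ * dist x₁ x₃ / 2))
    (l := Real.sin (√κ * dist x₂ x₄ / 2)) (pos h₁₂) (pos h₂₃) (pos h₃₄) (pos h₁₄)
    (Real.sin_nonneg_of_nonneg_of_le_pi (by positivity) (by linarith [le_pi x₂ x₄, Real.pi_pos]))
    ?_
  · linarith
  intro τ hτ
  obtain ⟨m, ρ, hρ, hρ2, hm⟩ := hX.exists_cone_division hκ hdiam x₂ x₄ hτ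
  have nn : ∀ d, 0 ≤ 1 + ρ ^ 2 - 2 * ρ * Real.cos d := fun d => by
    nlinarith [sq_nonneg (1 - ρ), Real.cos_le_one d]
  refine ⟨√(1 + ρ ^ 2 - 2 * ρ * Real.cos (√κ * dist x₁ m)),
    √(1 + ρ ^ 2 - 2 * ρ * Real.cos (√κ * dist x₃ m)), ?_, ?_, ?_⟩
  · refine two_mul_sin_half_le_cone (by positivity) ?_ ⟨by positivity, le_pi _ _⟩
      ⟨by positivity, le_pi _ _⟩ hρ (Real.sqrt_nonneg _) (Real.sqrt_nonneg _)
      (Real.sq_sqrt (nn _)) (Real.sq_sqrt (nn _))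
    rw [← mul_add, dist_comm x₃ m]
    exact mul_le_mul_of_nonneg_left (dist_triangle _ _ _) hK.le
  · have := hm x₁
    rw [Real.sq_sqrt (nn _), hρ2]
    linear_combination 2 * this - 2 * (1 - τ) * two_mul_sin_half_sq (√κ * dist x₁ x₂) -
      2 * τ * two_mul_sin_half_sq (√κ * dist x₁ x₄) +
      2 * τ * (1 - τ) * two_mul_sin_half_sq (√κ * dist x₂ x₄)
  · have := hm x₃
    rw [Real.sq_sqrt (nn _), hρ2]
    rw [dist_comm x₃ x₂] at this
    linear_combination 2 * this - 2 * (1 - τ) * two_mul_sin_half_sq (√κ * dist x₂ x₃) -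
      2 * τ * two_mul_sin_half_sq (√κ * dist x₃ x₄) +
      2 * τ * (1 - τ) * two_mul_sin_half_sq (√κ * dist x₂ x₄)

end Sphere

/-! ### The case `κ = 0` -/

theorem IsCAT.euclidean_ptolemy {X : Type*} [MetricSpace X] (hX : IsCAT 0 X) {x₁ x₂ x₃ x₄ : X}
    (h₁₂ : x₁ ≠ x₂) (h₂₃ : x₂ ≠ x₃) (h₃₄ : x₃ ≠ x₄) (h₁₄ : x₁ ≠ x₄) (h₂₄ : x₂ ≠ x₄) :
    dist x₁ x₃ * dist x₂ x₄ ≤ dist x₁ x₂ * dist x₃ x₄ + dist x₁ x₄ * dist x₂ x₃ := by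
  have pos : ∀ {x y : X}, x ≠ y → 0 < dist x y / 2 := fun h => half_pos (dist_pos.2 h)
  have := ptolemy_of_division (t := dist x₁ x₃) (pos h₁₂) (pos h₂₃) (pos h₃₄) (pos h₁₄)
    (pos h₂₄).le ?_
  · linarith
  intro τ hτ
  obtain ⟨S, hS⟩ := hX.exists_geodesic x₂ x₄ fun h => (lt_irrefl _ h).elim
  obtain ⟨c, c0, cL, hc, rfl⟩ := id hS
  have hL := dist_pos.2 h₂₄
  have mem : τ * dist x₂ x₄ ∈ Set.Icc 0 (dist x₂ x₄) :=
    ⟨mul_nonneg hτ.1 hL.le, mul_le_of_le_one_left hL.le hτ.2⟩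
  have d₁ := hc 0 ⟨le_rfl, hL.le⟩ _ mem
  have d₂ := hc _ mem _ ⟨hL.le, le_rfl⟩
  rw [c0, zero_sub, abs_neg, abs_of_nonneg mem.1] at d₁
  rw [cL, abs_sub_comm, abs_of_nonneg (sub_nonneg.2 mem.2), ← one_sub_mul] at d₂
  have key := fun p => hX.euclidean_stewart (p := p) hS ⟨_, mem, rfl⟩ hL hτ d₁ d₂
  refine ⟨dist x₁ (c (τ * dist x₂ x₄)), dist x₃ (c (τ * dist x₂ x₄)), ?_, ?_, ?_⟩
  · rw [dist_comm x₃]; exact dist_triangle _ _ _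
  · linear_combination key x₁
  · have := key x₃
    rw [dist_comm x₃ x₂] at this
    linear_combination this

/-! ### The case `κ < 0` -/

section Hyperbolic

variable {κ : ℝ} {X : Type*} [MetricSpace X]

/-- Lorentzian counterpart of `exists_cone_division`: `ρ` is the Lorentz norm of the point dividing
the chord between two vectors of the hyperboloid, and `m` its direction. -/
theorem IsCAT.exists_hyperbolic_division (hX : IsCAT κ X) (hκ : κ < 0) {q r : X} (hqr : q ≠ r)
    {τ : ℝ} (hτ : τ ∈ Set.Icc (0 : ℝ) 1) :
    ∃ (m : X) (ρ : ℝ), 0 < ρ ∧ ρ ^ 2 = (1 - τ) ^ 2 + τ ^ 2 +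
        2 * τ * (1 - τ) * Real.cosh (√(-κ) * dist q r) ∧
      ∀ p, ρ * Real.cosh (√(-κ) * dist p m) ≤
        (1 - τ) * Real.cosh (√(-κ) * dist p q) + τ * Real.cosh (√(-κ) * dist p r) := by
  have hK := Real.sqrt_pos.2 (neg_pos.2 hκ)
  obtain ⟨S, hS⟩ := hX.exists_geodesic q r fun h => (lt_asymm h hκ).elim
  obtain ⟨c, c0, cL, hc, rfl⟩ := id hS
  have hL := dist_pos.2 hqr
  obtain ⟨hτ0, hτ1⟩ := hτ
  have hτ1' := sub_nonneg.2 hτ1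
  have hst := fun p m hm => hX.hyperbolic_stewart hκ (p := p) (m := m) hS hm hL
  set L := dist q r with hLdef
  have hsinL : 0 < Real.sinh (√(-κ) * L) := Real.sinh_pos_iff.2 (by positivity)
  -- Again the components transverse to `c s` cancel.
  obtain ⟨s, hs, hs'⟩ : ∃ s ∈ Set.Icc 0 L,
      (1 - τ) * Real.sinh (√(-κ) * s) - τ * Real.sinh (√(-κ) * (L - s)) = 0 := by
    refine intermediate_value_Icc hL.le (f := fun s => (1 - τ) * Real.sinh (√(-κ) * s) -
      τ * Real.sinh (√(-κ) * (L - s))) (by fun_prop) ⟨?_, ?_⟩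
    · simp; positivity
    · simp; positivity
  have d₁ := hc 0 ⟨le_rfl, hL.le⟩ _ hs
  have d₂ := hc _ hs _ ⟨hL.le, le_rfl⟩
  rw [c0, zero_sub, abs_neg, abs_of_nonneg hs.1] at d₁
  rw [cL, abs_sub_comm, abs_of_nonneg (sub_nonneg.2 hs.2)] at d₂
  set ρ := (1 - τ) * Real.cosh (√(-κ) * s) + τ * Real.cosh (√(-κ) * (L - s)) with hρ
  have e : Real.sinh (√(-κ) * L) = Real.sinh (√(-κ) * s) * Real.cosh (√(-κ) * (L - s)) +
      Real.cosh (√(-κ) * s) * Real.sinh (√(-κ) * (L - s)) := by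
    rw [← Real.sinh_add]; ring_nf
  have e' : Real.cosh (√(-κ) * L) = Real.cosh (√(-κ) * s) * Real.cosh (√(-κ) * (L - s)) +
      Real.sinh (√(-κ) * s) * Real.sinh (√(-κ) * (L - s)) := by
    rw [← Real.cosh_add]; ring_nf
  have k₁ : ρ * Real.sinh (√(-κ) * (L - s)) = (1 - τ) * Real.sinh (√(-κ) * L) := by
    rw [hρ, e]; linear_combination -Real.cosh (√(-κ) * (L - s)) * hs'
  have k₂ : ρ * Real.sinh (√(-κ) * s) = τ * Real.sinh (√(-κ) * L) := by
    rw [hρ, e]; linear_combination Real.cosh (√(-κ) * s) * hs'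
  have hρ0 : 0 < ρ := by
    nlinarith [Real.one_le_cosh (√(-κ) * s), Real.one_le_cosh (√(-κ) * (L - s))]
  refine ⟨c s, ρ, hρ0, ?_, fun p => ?_⟩
  · rw [e', hρ]
    linear_combination hs' * ((1 - τ) * Real.sinh (√(-κ) * s) - τ * Real.sinh (√(-κ) * (L - s))) +
      (1 - τ) ^ 2 * Real.cosh_sq (√(-κ) * s) + τ ^ 2 * Real.cosh_sq (√(-κ) * (L - s))
  · have key := mul_le_mul_of_nonneg_left
      (hst p (c s) ⟨s, hs, rfl⟩ (by rw [d₁, d₂]; ring)) hρ0.le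
    rw [d₁, d₂] at key
    refine le_of_mul_le_mul_left ?_ hsinL
    linear_combination key + Real.cosh (√(-κ) * dist p q) * k₁ + Real.cosh (√(-κ) * dist p r) * k₂

theorem IsCAT.hyperbolic_ptolemy (hX : IsCAT κ X) (hκ : κ < 0) {x₁ x₂ x₃ x₄ : X} (h₁₂ : x₁ ≠ x₂)
    (h₂₃ : x₂ ≠ x₃) (h₃₄ : x₃ ≠ x₄) (h₁₄ : x₁ ≠ x₄) (h₂₄ : x₂ ≠ x₄) :
    Real.sinh (√(-κ) * dist x₁ x₃ / 2) * Real.sinh (√(-κ) * dist x₂ x₄ / 2) ≤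
      Real.sinh (√(-κ) * dist x₁ x₂ / 2) * Real.sinh (√(-κ) * dist x₃ x₄ / 2) +
        Real.sinh (√(-κ) * dist x₁ x₄ / 2) * Real.sinh (√(-κ) * dist x₂ x₃ / 2) := by
  have hK := Real.sqrt_pos.2 (neg_pos.2 hκ)
  have pos : ∀ {x y : X}, x ≠ y → 0 < Real.sinh (√(-κ) * dist x y / 2) := fun {x y} h => by
    have := dist_pos.2 h
    exact Real.sinh_pos_iff.2 (by positivity)
  have := hyperbolic_ptolemy_of_division (t := Real.cosh (√(-κ) * dist x₁ x₃)) (pos h₁₂) (pos h₂₃)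
    (pos h₃₄) (pos h₁₄) (pos h₂₄) ?_
  · have p₁ := pos h₁₂
    have p₂ := pos h₂₃
    have p₃ := pos h₃₄
    have p₄ := pos h₁₄
    refine abs_le_of_sq_le_sq' ?_ (by positivity) |>.2
    rw [← two_mul_sinh_half_sq] at this
    linear_combination this / 2
  intro τ hτ
  obtain ⟨m, ρ, hρ, hρ2, hm⟩ := hX.exists_hyperbolic_division hκ h₂₄ hτ
  refine ⟨ρ, √(-κ) * dist x₁ m, √(-κ) * dist x₃ m, hρ, by positivity, by positivity, ?_, ?_, ?_, ?_⟩
  · rw [Real.cosh_le_cosh, abs_of_nonneg (by positivity), abs_of_nonneg (by positivity), ← mul_add,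
      dist_comm x₃ m]
    exact mul_le_mul_of_nonneg_left (dist_triangle _ _ _) hK.le
  · rw [hρ2]
    linear_combination -2 * τ * (1 - τ) * two_mul_sinh_half_sq (√(-κ) * dist x₂ x₄)
  · have := hm x₁
    linear_combination this - (1 - τ) * two_mul_sinh_half_sq (√(-κ) * dist x₁ x₂) -
      τ * two_mul_sinh_half_sq (√(-κ) * dist x₁ x₄)
  · have := hm x₃
    rw [dist_comm x₃ x₂] at this
    linear_combination this - (1 - τ) * two_mul_sinh_half_sq (√(-κ) * dist x₂ x₃) -
      τ * two_mul_sinh_half_sq (√(-κ) * dist x₃ x₄)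

end Hyperbolic

/-! ### Degenerate quadruples and assembly -/

/-- It suffices to verify the `PT_κ` inequality for quadruples in general position. -/
theorem satisfiesPT_of_ne {κ : ℝ} {X : Type*} [MetricSpace X]
    (hnn : ∀ x y : X, 0 ≤ sn κ (dist x y / 2))
    (h : ∀ x₁ x₂ x₃ x₄ : X, x₁ ≠ x₂ → x₂ ≠ x₃ → x₃ ≠ x₄ → x₁ ≠ x₄ → x₂ ≠ x₄ →
      sn κ (dist x₁ x₃ / 2) * sn κ (dist x₂ x₄ / 2) ≤
      sn κ (dist x₁ x₂ / 2) * sn κ (dist x₃ x₄ / 2) +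
        sn κ (dist x₁ x₄ / 2) * sn κ (dist x₂ x₃ / 2)) : SatisfiesPT κ X := by
  intro x₁ x₂ x₃ x₄
  have h0 : sn κ 0 = 0 := by simp [sn]
  have p₁ := mul_nonneg (hnn x₁ x₂) (hnn x₃ x₄)
  have p₂ := mul_nonneg (hnn x₁ x₄) (hnn x₂ x₃)
  rcases eq_or_ne x₂ x₄ with rfl | h₂₄
  · rw [dist_self, zero_div, h0, mul_zero]
    positivity
  rcases eq_or_ne x₁ x₂ with rfl | h₁₂
  · simp [h0, mul_comm]
  rcases eq_or_ne x₂ x₃ with rfl | h₂₃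
  · simp [h0]
  rcases eq_or_ne x₃ x₄ with rfl | h₃₄
  · simp [h0]
  rcases eq_or_ne x₁ x₄ with rfl | h₁₄
  · simp [h0, dist_comm, mul_comm]
  exact h x₁ x₂ x₃ x₄ h₁₂ h₂₃ h₃₄ h₁₄ h₂₄

end CATPT

theorem mainTheorem6 (κ : ℝ) (X : Type*) [MetricSpace X] (hX : CATPT.IsCAT κ X)
    (hdiam : 0 < κ → ∀ x y : X, dist x y ≤ Real.pi / √κ) :
    CATPT.SatisfiesPT κ X := by
  rcases lt_trichotomy κ 0 with hκ | rfl | hκ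
  · have hsn : ∀ t, CATPT.sn κ (t / 2) = 1 / √(-κ) * Real.sinh (√(-κ) * t / 2) := fun t => by
      rw [CATPT.sn, if_neg hκ.not_gt, if_neg hκ.ne, mul_div_assoc]
    refine CATPT.satisfiesPT_of_ne (fun x y => ?_) fun x₁ x₂ x₃ x₄ h₁₂ h₂₃ h₃₄ h₁₄ h₂₄ => ?_
    · rw [hsn]
      exact mul_nonneg (by positivity) (Real.sinh_nonneg_iff.2 (by positivity))
    · simp only [hsn]
      linear_combination (1 / √(-κ)) ^ 2 * hX.hyperbolic_ptolemy hκ h₁₂ h₂₃ h₃₄ h₁₄ h₂₄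
  · have hsn : ∀ t, CATPT.sn 0 t = t := fun t => by simp [CATPT.sn]
    refine CATPT.satisfiesPT_of_ne (fun x y => ?_) fun x₁ x₂ x₃ x₄ h₁₂ h₂₃ h₃₄ h₁₄ h₂₄ => ?_
    · rw [hsn]; positivity
    · simp only [hsn]
      linear_combination hX.euclidean_ptolemy h₁₂ h₂₃ h₃₄ h₁₄ h₂₄ / 4
  · have hK := Real.sqrt_pos.2 hκ
    have hsn : ∀ t, CATPT.sn κ (t / 2) = 1 / √κ * Real.sin (√κ * t / 2) := fun t => by
      rw [CATPT.sn, if_pos hκ, mul_div_assoc]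
    refine CATPT.satisfiesPT_of_ne (fun x y => ?_) fun x₁ x₂ x₃ x₄ h₁₂ h₂₃ h₃₄ h₁₄ _ => ?_
    · have : √κ * dist x y ≤ Real.pi := by
        rw [mul_comm, ← le_div_iff₀ hK]; exact hdiam hκ x y
      rw [hsn]
      exact mul_nonneg (by positivity) (Real.sin_nonneg_of_nonneg_of_le_pi (by positivity)
        (by linarith [Real.pi_pos]))
    · simp only [hsn]
      linear_combination (1 / √κ) ^ 2 * hX.spherical_ptolemy hκ (hdiam hκ) h₁₂ h₂₃ h₃₄ h₁₄
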